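/- All graphs are finite and simple and all edge-colorings are proper (edges sharing a vertex get different colors). A leaf of a graph is an edge one of whose endpoints has degree $1$. A pre-coloring of a set $P$ of leaves is a proper coloring of the edges in $P$ with arbitrary colors; it extends to an edge-coloring of $G$ with at most $N$ colors if there is a proper edge-coloring of $G$ that agrees with it on $P$ and uses at most $N$ different colors in total (those used on $P$ included). (1) There is $d_0$ such that for every integer $d\ge d_0$ and every finite graph $G$ with maximum degree $\Delta(G)\le d$, every pre-coloring of at most $d$ leaves of $G$ extends to an edge-coloring of $G$ that uses at most $d+9\sqrt d$ colors. (2) For an integer $k\ge 1$, let $f(k)$ be the smallest integer $f$ such that for every $d\in\{1,\dots,k\}$ the following holds: if $G$ is a finite graph in which every vertex has degree at most $d$, except for at most one vertex of degree $d+1$, then every pre-coloring of at most $d-1$ leaves of $G$ extends to an edge-coloring of $G$ that uses at most $d+f$ colors. Then $f(k)$ is well defined for every $k\ge1$, and $f(k)=O(\sqrt k)$ as $k\to\infty$. -/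

import Mathlib

namespace EdgePrecoloring

/-- `c` is a proper coloring of the edges in `S`: distinct edges of `S` that share a vertex get
different colors. (Values of `c` outside `S` are irrelevant.) -/
def IsProperOn {V : Type*} (S : Set (Sym2 V)) (c : Sym2 V → ℕ) : Prop :=
  ∀ e ∈ S, ∀ e' ∈ S, e ≠ e' → (∃ v, v ∈ e ∧ v ∈ e') → c e ≠ c e'

/-- A leaf: an edge of `G` one of whose endpoints has degree `1`. -/
def IsLeafEdge {V : Type*} [Fintype V] (G : SimpleGraph V) [DecidableRel G.Adj]
    (e : Sym2 V) : Prop :=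
  e ∈ G.edgeSet ∧ ∃ v ∈ e, G.degree v = 1

/-- Every proper pre-coloring `c₀` of a set `P` of at most `m` leaves of `G` extends to a proper
edge-coloring `c` of the whole graph `G` that uses at most `N` different colors in total
(the colors of the pre-colored leaves included). -/
def LeafPrecoloringsExtend {V : Type*} [Fintype V] (G : SimpleGraph V) [DecidableRel G.Adj]
    (m : ℕ) (N : ℝ) : Prop :=
  ∀ (P : Finset (Sym2 V)) (c₀ : Sym2 V → ℕ),
    (∀ e ∈ P, IsLeafEdge G e) → P.card ≤ m → IsProperOn (P : Set (Sym2 V)) c₀ →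
    ∃ c : Sym2 V → ℕ,
      IsProperOn G.edgeSet c ∧ (∀ e ∈ P, c e = c₀ e) ∧ ((c '' G.edgeSet).ncard : ℝ) ≤ N

/-- The integers `f` such that for every `d` with `1 ≤ d ≤ k` and every finite graph `G` all of
whose degrees are at most `d`, except for at most one vertex of degree `d + 1`, every pre-coloring
of at most `d - 1` leaves extends to an edge-coloring of `G` with at most `d + f` colors. -/
def admissible (k : ℕ) : Set ℤ :=
  {f : ℤ | ∀ d : ℕ, 1 ≤ d → d ≤ k →
    ∀ (V : Type) [Fintype V] (G : SimpleGraph V) [DecidableRel G.Adj],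
      (∀ v, G.degree v ≤ d + 1) →
      (∀ v w, G.degree v = d + 1 → G.degree w = d + 1 → v = w) →
      LeafPrecoloringsExtend G (d - 1) ((d : ℝ) + (f : ℝ))}

/-- The smallest admissible integer for `k` (meaningful for `k ≥ 1`). -/
noncomputable def f (k : ℕ) : ℤ := sInf (admissible k)

end EdgePrecoloring

/-! Let `q = ⌊√d⌋`. Call a vertex big if its pre-colored leaves carry more than `q` colors; at most
`d` leaves are pre-colored, so the set `B` of big vertices has at most `q` elements. Take a palette
`Q` of `d + 2q` colors containing all prescribed ones, and `6q` fresh colors. The edges between `B`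
and its complement are colored greedily from `Q`. A vertex `v` outside `B` then has a set `S v` of
at most `2q` colors blocked by leaves and cross edges. The rest of the graph outside `B` gets a
Vizing coloring from `Q`, whose color names are permuted at random. At a given vertex the expected
number of edges whose color is blocked at the far end is at most `2q`, and a factorial moment bound
gives probability at most `(2/3)^q` for `4q` or more. Only polynomially many vertices (in `d`) can
be affected, so for large `d` some permutation is good everywhere. At most `2q` further edges at a
vertex have a color blocked at the near end, because the coloring is proper. Hence the conflicting
edges, together with the edges inside `B`, form a graph of maximum degree below `6q`, which Vizing's
theorem colors with the fresh colors. The total is `d + 8q ≤ d + 9√d`. Part (2) follows from part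
(1) with `d + 1` in place of `d`; the finitely many small `d` cost only a constant. The pillars are
`exists_isProperOn_edgeSet` (Vizing), `exists_perm_few_hits` and `exists_extension_of_card_le`. -/

namespace EdgePrecoloring

/-! ### Vizing's theorem -/

section Vizing

variable {V K : Type*}

/-- A proper partial edge-coloring, as a symmetric function on pairs of vertices. -/
structure IsPartialColoring (c : V → V → Option K) : Prop where
  symm : ∀ v w, c v w = c w v
  irrefl : ∀ v, c v v = none
  inj : ∀ {v w w' a}, c v w = some a → c v w' = some a → w = w'

/-- The color `a` is not used at the vertex `v`. -/
def Missing (c : V → V → Option K) (v : V) (a : K) : Prop := ∀ w, c v w ≠ some a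

open Classical in
/-- Give the pair `x y` the color `a`. -/
noncomputable def recolor (c : V → V → Option K) (x y : V) (a : K) : V → V → Option K :=
  fun v w => if (v = x ∧ w = y) ∨ (v = y ∧ w = x) then some a else c v w

theorem IsPartialColoring.recolor {c : V → V → Option K} (hc : IsPartialColoring c) {x y : V}
    (hxy : x ≠ y) {a : K} (hx : Missing c x a) (hy : Missing c y a) :
    IsPartialColoring (recolor c x y a) := by
  have hs := hc.symm
  have hi := hc.irrefl
  refine ⟨fun v w => ?_, fun v => ?_, fun {v w w' b} h h' => ?_⟩
  · unfold EdgePrecoloring.recolor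
    rw [hs v w]
    congr 1
    apply propext
    tauto
  · unfold EdgePrecoloring.recolor
    rw [if_neg, hi]
    rintro (⟨h1, h2⟩ | ⟨h1, h2⟩)
    · exact hxy (h1.symm.trans h2)
    · exact hxy (h2.symm.trans h1)
  · unfold EdgePrecoloring.recolor at h h'
    split_ifs at h h' with h1 h2 h2
    · grind
    · cases h
      rcases h1 with ⟨rfl, rfl⟩ | ⟨rfl, rfl⟩
      · exact absurd h' (hx _)
      · exact absurd h' (hy _)
    · cases h'
      rcases h2 with ⟨rfl, rfl⟩ | ⟨rfl, rfl⟩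
      · exact absurd h (hx _)
      · exact absurd h (hy _)
    · exact hc.inj h h'

theorem recolor_of_ne {c : V → V → Option K} {x y v : V} {a : K} (hx : v ≠ x) (hy : v ≠ y)
    (w : V) : recolor c x y a v w = c v w := by
  unfold recolor
  rw [if_neg]
  tauto

/-- The two colors `a`, `b` span this graph. -/
def twoColorGraph (c : V → V → Option K) (hc : IsPartialColoring c) (a b : K) :
    SimpleGraph V where
  Adj v w := c v w = some a ∨ c v w = some b
  symm := ⟨fun v w h => by rwa [hc.symm w v]⟩
  loopless := ⟨fun v h => by simp [hc.irrefl] at h⟩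

open Classical in
/-- Kempe swap of the colors `a`, `b` on the vertex set `Z`. -/
noncomputable def kempe (c : V → V → Option K) (a b : K) (Z : Set V) : V → V → Option K :=
  fun v w => if v ∈ Z then (c v w).map (Equiv.swap a b) else c v w

/-- `Z` is a union of components of the two-color graph, so an edge leaving `Z` has neither color
and the swap fixes it. This keeps the swapped coloring symmetric. -/
theorem IsPartialColoring.kempe {c : V → V → Option K} (hc : IsPartialColoring c) {a b : K}
    {Z : Set V} (hZ : ∀ v w, (twoColorGraph c hc a b).Adj v w → (v ∈ Z ↔ w ∈ Z)) :
    IsPartialColoring (kempe c a b Z) := by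
  classical
  refine ⟨fun v w => ?_, fun v => ?_, fun {v w w' e} h h' => ?_⟩
  · unfold EdgePrecoloring.kempe
    rw [hc.symm w v]
    by_cases hvw : (twoColorGraph c hc a b).Adj v w
    · simp only [hZ v w hvw]
    · have : (c v w).map (Equiv.swap a b) = c v w := by
        cases h : c v w with
        | none => rfl
        | some e =>
          simp only [twoColorGraph, h, Option.some.injEq, not_or] at hvw
          simp [Equiv.swap_apply_of_ne_of_ne hvw.1 hvw.2]
      simp [this]
  · unfold EdgePrecoloring.kempe
    simp [hc.irrefl]
  · unfold EdgePrecoloring.kempe at h h'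
    split_ifs at h h' with hv
    · rw [Option.map_eq_some_iff] at h h'
      obtain ⟨e1, h1, h2⟩ := h
      obtain ⟨e2, h3, h4⟩ := h'
      have : e1 = e2 := (Equiv.swap a b).injective (h2.trans h4.symm)
      subst this
      exact hc.inj h1 h3
    · exact hc.inj h h'

theorem kempe_eq_none_iff {c : V → V → Option K} {a b : K} {Z : Set V} {v w : V} :
    kempe c a b Z v w = none ↔ c v w = none := by
  unfold kempe
  split_ifs <;> simp

theorem missing_kempe_of_notMem {c : V → V → Option K} {a b : K} {Z : Set V} {v : V} {e : K}
    (hv : v ∉ Z) : Missing (kempe c a b Z) v e ↔ Missing c v e := by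
  simp [Missing, kempe, hv]

theorem missing_kempe_of_mem {c : V → V → Option K} {a b : K} {Z : Set V} {v : V} {e : K}
    (hv : v ∈ Z) [DecidableEq K] :
    Missing (kempe c a b Z) v e ↔ Missing c v (Equiv.swap a b e) := by
  have : ∀ w, kempe c a b Z v w = some e ↔ c v w = some (Equiv.swap a b e) := by
    intro w
    have hk : kempe c a b Z v w = (c v w).map (Equiv.swap a b) := by
      simp only [kempe, hv, if_true]
      congr!
    rw [hk, Option.map_eq_some_iff]
    constructor
    · rintro ⟨f, hf, rfl⟩
      simpa using hf
    · intro h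
      exact ⟨_, h, by simp⟩
  simp [Missing, this]

/-- `FanReach c x y₀ n y`: the vertex `y` lies on a fan at `x` starting at `y₀` after at most `n`
steps. -/
def FanReach (c : V → V → Option K) (x y₀ : V) : ℕ → V → Prop
  | 0, y => y = y₀
  | n + 1, y => FanReach c x y₀ n y ∨
      ∃ z a, FanReach c x y₀ n z ∧ c x y = some a ∧ Missing c z a

theorem FanReach.mono {c : V → V → Option K} {x y₀ y : V} {m n : ℕ} (hmn : m ≤ n)
    (h : FanReach c x y₀ m y) : FanReach c x y₀ n y := by
  induction hmn with
  | refl => exact h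
  | step _ ih => exact Or.inl ih

/-- `c'` colors what `c` does and, in addition, the pair `x y`. -/
def ExtendsBy (c c' : V → V → Option K) (x y : V) : Prop :=
  ∀ v w, c' v w ≠ none ↔ c v w ≠ none ∨ s(v, w) = s(x, y)

/-- Fan rotation: give `x y` the color `a`. This frees its old color `b` at `x`, and `b` is missing
at the predecessor `z`, which is reached in fewer steps. -/
theorem exists_extendsBy_of_fanReach {x y₀ : V} (hxy : x ≠ y₀) (n : ℕ) :
    ∀ (c : V → V → Option K), IsPartialColoring c → c x y₀ = none →
    ∀ y a, FanReach c x y₀ n y → Missing c x a → Missing c y a →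
    ∃ c', IsPartialColoring c' ∧ ExtendsBy c c' x y₀ := by
  classical
  induction n with
  | zero =>
    intro c hc h0 y a hy hxa hya
    cases hy
    refine ⟨_, hc.recolor hxy hxa hya, fun v w => ?_⟩
    unfold recolor
    rw [Sym2.eq_iff]
    split_ifs with h
    · simp [h]
    · simp [h]
  | succ n ih =>
    intro c hc h0 y a hy hxa hya
    by_cases hyn : FanReach c x y₀ n y
    · exact ih c hc h0 y a hyn hxa hya
    obtain ⟨z, b, hz, hyb, hzb⟩ := hy.resolve_left hyn
    have hne : x ≠ y := by
      rintro rfl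
      simp [hc.irrefl] at hyb
    have hy0 : y ≠ y₀ := by
      rintro rfl
      simp [h0] at hyb
    have hab : a ≠ b := by
      rintro rfl
      exact hxa _ hyb
    set c₁ := recolor c x y a with hc₁
    have hc₁' : IsPartialColoring c₁ := hc.recolor hne hxa hya
    have hxw : ∀ w, w ≠ y → c₁ x w = c x w := by
      intro w hw
      simp only [hc₁, recolor]
      rw [if_neg]
      tauto
    -- Recoloring `x y` affects only `x` and `y`, and `y` is not reached within `n` steps, so the
    -- shorter fan survives.
    have key : ∀ m, m ≤ n → ∀ u, FanReach c x y₀ m u → FanReach c₁ x y₀ m u := by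
      intro m
      induction m with
      | zero => exact fun _ u hu => hu
      | succ m ihm =>
        intro hm u hu
        rcases hu with hu | ⟨t, e, ht, hue, hte⟩
        · exact Or.inl (ihm (by omega) u hu)
        · refine Or.inr ⟨t, e, ihm (by omega) t ht, ?_, ?_⟩
          · rw [hxw, hue]
            rintro rfl
            exact hyn (FanReach.mono hm (Or.inr ⟨t, e, ht, hue, hte⟩))
          · intro w
            have hty : t ≠ y := by
              rintro rfl
              exact hyn (FanReach.mono (by omega) ht)
            by_cases htx : t = x
            · subst htx
              exact absurd hue (hte _)
            rw [hc₁, recolor_of_ne htx hty]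
            exact hte w
    have hzx : z ≠ x := by
      rintro rfl
      exact hzb _ hyb
    have hzy : z ≠ y := by
      rintro rfl
      exact hyn hz
    obtain ⟨c', hc', hext⟩ := ih c₁ hc₁' (by rw [hxw _ hy0.symm, h0]) z b (key n le_rfl z hz)
      (by
        intro w hw
        by_cases hwy : w = y
        · subst hwy
          simp [hc₁, recolor, hab] at hw
        · rw [hxw w hwy] at hw
          exact hwy (hc.inj hw hyb))
      (by
        intro w
        rw [hc₁, recolor_of_ne hzx hzy]
        exact hzb w)
    refine ⟨c', hc', fun v w => ?_⟩
    rw [hext v w]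
    have : c₁ v w ≠ none ↔ c v w ≠ none := by
      simp only [hc₁, recolor]
      split_ifs with h
      · rcases h with ⟨rfl, rfl⟩ | ⟨rfl, rfl⟩
        · simp [hyb]
        · simp [hc.symm _ w, hyb]
      · rfl
    rw [this]

/-- A connected component of a graph with all degrees at most `2` has at most two vertices of
degree at most `1`. -/
theorem not_reachable_of_three_ends [Fintype V] (H : SimpleGraph V) [DecidableRel H.Adj]
    (h2 : ∀ v, H.degree v ≤ 2) {x y z : V} (hxy : x ≠ y) (hxz : x ≠ z) (hyz : y ≠ z)
    (hx : H.degree x ≤ 1) (hy : H.degree y ≤ 1) (hz : H.degree z ≤ 1)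
    (h1 : H.Reachable x y) (h3 : H.Reachable x z) : False := by
  classical
  let C := H.connectedComponentMk x
  have hconn : C.toSimpleGraph.Connected := C.connected_toSimpleGraph
  have hcard := hconn.card_vert_le_card_edgeSet_add_one
  have hsum := C.toSimpleGraph.sum_degrees_eq_twice_card_edges
  have hdeg : ∀ v : C, C.toSimpleGraph.degree v ≤ H.degree v := by
    intro v
    rw [← SimpleGraph.card_neighborFinset_eq_degree, ← SimpleGraph.card_neighborFinset_eq_degree]
    refine Finset.card_le_card_of_injOn Subtype.val ?_ Subtype.val_injective.injOn
    intro w hw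
    simp only [SimpleGraph.mem_neighborFinset, Finset.mem_coe] at hw ⊢
    exact hw
  let X : C := ⟨x, rfl⟩
  let Y : C := ⟨y, SimpleGraph.ConnectedComponent.sound h1.symm⟩
  let Z : C := ⟨z, SimpleGraph.ConnectedComponent.sound h3.symm⟩
  -- A connected graph on `n` vertices has degree sum at least `2n - 2`; three ends would force at
  -- most `2n - 3`.
  have hle : ∑ v : C, (C.toSimpleGraph.degree v + if v = X ∨ v = Y ∨ v = Z then 1 else 0)
      ≤ ∑ _v : C, 2 := by
    refine Finset.sum_le_sum fun v _ => ?_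
    split_ifs with h
    · have := hdeg v
      rcases h with rfl | rfl | rfl
      · have : H.degree X.1 ≤ 1 := hx
        omega
      · have : H.degree Y.1 ≤ 1 := hy
        omega
      · have : H.degree Z.1 ≤ 1 := hz
        omega
    · have := hdeg v
      have := h2 v
      omega
  rw [Finset.sum_add_distrib, ← Finset.card_filter, hsum] at hle
  have h3c : (Finset.univ.filter fun v : C => v = X ∨ v = Y ∨ v = Z).card = 3 := by
    have : (Finset.univ.filter fun v : C => v = X ∨ v = Y ∨ v = Z) = {X, Y, Z} := by
      ext v
      simp
    rw [this, Finset.card_eq_three]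
    exact ⟨X, Y, Z, fun h => hxy (congrArg Subtype.val h),
      fun h => hxz (congrArg Subtype.val h), fun h => hyz (congrArg Subtype.val h), rfl⟩
  rw [h3c] at hle
  simp only [Finset.sum_const, Finset.card_univ, smul_eq_mul] at hle
  rw [Nat.card_eq_fintype_card, Nat.card_eq_fintype_card, ← SimpleGraph.edgeFinset_card] at hcard
  omega

theorem degree_twoColorGraph_le [Fintype V] {c : V → V → Option K} (hc : IsPartialColoring c)
    (a b : K) [DecidableRel (twoColorGraph c hc a b).Adj] (v : V) (T : Finset K)
    (hT : ∀ e, (e = a ∨ e = b) → ¬ Missing c v e → e ∈ T) :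
    (twoColorGraph c hc a b).degree v ≤ T.card := by
  classical
  rw [← SimpleGraph.card_neighborFinset_eq_degree, ← Finset.card_image_of_injective T
    (Option.some_injective K)]
  refine Finset.card_le_card_of_injOn (c v) ?_ ?_
  · intro w hw
    simp only [SimpleGraph.mem_neighborFinset, Finset.mem_coe, Finset.mem_image] at hw ⊢
    rcases hw with h | h
    · exact ⟨a, hT a (Or.inl rfl) (fun hm => hm w h), h.symm⟩
    · exact ⟨b, hT b (Or.inr rfl) (fun hm => hm w h), h.symm⟩
  · intro w hw w' hw' h
    simp only [SimpleGraph.mem_neighborFinset, Finset.mem_coe] at hw hw'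
    rcases hw with hw | hw
    · exact hc.inj hw (h ▸ hw)
    · exact hc.inj hw (h ▸ hw)

/-- Swapping `a` and `b` on the component of `z` leaves the colors at `x` alone and makes `a`
missing at `z`. The swap can break the fan only where a vertex missing `b` was used, and that vertex
now misses `a`; either way a fan vertex shares `a` with `x`. -/
theorem exists_extendsBy_of_not_reachable {c : V → V → Option K}
    (hc : IsPartialColoring c) {x y₀ z : V} (hxy : x ≠ y₀) (h0 : c x y₀ = none) {a b : K}
    (hxa : Missing c x a) {n : ℕ} (hz : FanReach c x y₀ n z) (hzb : Missing c z b)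
    (hxz : ¬ (twoColorGraph c hc a b).Reachable z x) :
    ∃ c', IsPartialColoring c' ∧ ExtendsBy c c' x y₀ := by
  classical
  let H := twoColorGraph c hc a b
  let Z : Set V := {v | H.Reachable z v}
  let c₁ := kempe c a b Z
  have hc₁ : IsPartialColoring c₁ := hc.kempe fun v w hvw =>
    ⟨fun h => h.trans (SimpleGraph.Adj.reachable hvw),
      fun h => h.trans (SimpleGraph.Adj.reachable hvw).symm⟩
  have hxZ : x ∉ Z := hxz
  have hx1 : ∀ w, c₁ x w = c x w := fun w => by simp [c₁, kempe, hxZ]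
  have key : ∀ m u, FanReach c x y₀ m u → FanReach c₁ x y₀ m u ∨
      ∃ w, FanReach c₁ x y₀ m w ∧ Missing c₁ w a := by
    intro m
    induction m with
    | zero => exact fun u hu => Or.inl hu
    | succ m ih =>
      intro u hu
      rcases hu with hu | ⟨t, e, ht, hue, hte⟩
      · rcases ih u hu with h | ⟨w, hw, hwa⟩
        · exact Or.inl (Or.inl h)
        · exact Or.inr ⟨w, Or.inl hw, hwa⟩
      · rcases ih t ht with h | ⟨w, hw, hwa⟩
        · by_cases htZ : t ∈ Z
          · have hea : e ≠ a := by
              rintro rfl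
              exact hxa _ hue
            by_cases heb : e = b
            · subst heb
              refine Or.inr ⟨t, Or.inl h, ?_⟩
              rw [missing_kempe_of_mem htZ]
              simpa using hte
            · refine Or.inl (Or.inr ⟨t, e, h, by rw [hx1, hue], ?_⟩)
              rw [missing_kempe_of_mem htZ, Equiv.swap_apply_of_ne_of_ne hea heb]
              exact hte
          · refine Or.inl (Or.inr ⟨t, e, h, by rw [hx1, hue], ?_⟩)
            rwa [missing_kempe_of_notMem htZ]
        · exact Or.inr ⟨w, Or.inl hw, hwa⟩
  have hend : ∃ w, FanReach c₁ x y₀ n w ∧ Missing c₁ w a := by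
    rcases key n z hz with h | h
    · refine ⟨z, h, ?_⟩
      rw [missing_kempe_of_mem (show z ∈ Z from SimpleGraph.Reachable.refl z)]
      simpa using hzb
    · exact h
  obtain ⟨w, hw, hwa⟩ := hend
  obtain ⟨c', hc', hext⟩ := exists_extendsBy_of_fanReach hxy n c₁ hc₁ (by rw [hx1, h0]) w a hw
    ((missing_kempe_of_notMem hxZ).2 hxa) hwa
  refine ⟨c', hc', fun v w => ?_⟩
  rw [hext v w, Ne, kempe_eq_none_iff]

theorem exists_extendsBy [Fintype V] {c : V → V → Option K} (hc : IsPartialColoring c)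
    (hm : ∀ v, ∃ a, Missing c v a) {x y₀ : V} (hxy : x ≠ y₀) (h0 : c x y₀ = none) :
    ∃ c', IsPartialColoring c' ∧ ExtendsBy c c' x y₀ := by
  classical
  by_contra hno
  choose m hm using hm
  let R : Finset V := Finset.univ.filter fun y => ∃ n, FanReach c x y₀ n y
  have hpres : ∀ y ∈ R, ∃ w, c x w = some (m y) := by
    intro y hy
    by_contra hcon
    push Not at hcon
    obtain ⟨n, hn⟩ := (Finset.mem_filter.1 hy).2
    exact hno (exists_extendsBy_of_fanReach hxy n c hc h0 y (m y) hn hcon (hm y))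
  have hxR : x ∉ R := by
    intro h
    obtain ⟨n, hn⟩ := (Finset.mem_filter.1 h).2
    induction n with
    | zero => exact hxy hn
    | succ n ih =>
      rcases hn with hn | ⟨z, a, -, h, -⟩
      · exact ih hn
      · simp [hc.irrefl] at h
  -- Each `m y` with `y ∈ R` occurs at `x`, on an edge leading back into `R` but not to `y₀`. If `m`
  -- were injective, `R` would inject into `R` without `y₀`.
  by_cases hinj : Set.InjOn m R
  · choose! g hg using hpres
    have hmem : y₀ ∈ R := Finset.mem_filter.2 ⟨Finset.mem_univ _, 0, rfl⟩
    have hle : R.card ≤ (R.erase y₀).card := by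
      refine Finset.card_le_card_of_injOn g ?_ ?_
      · intro y hy
        obtain ⟨n, hn⟩ := (Finset.mem_filter.1 hy).2
        refine Finset.mem_erase.2 ⟨?_, Finset.mem_filter.2 ⟨Finset.mem_univ _, n + 1,
          Or.inr ⟨y, m y, hn, hg y hy, hm y⟩⟩⟩
        intro h
        have := hg y hy
        rw [h, h0] at this
        simp at this
      · intro y hy z hz h
        refine hinj hy hz (Option.some_injective _ ?_)
        rw [← hg y hy, ← hg z hz, h]
    exact absurd hle (not_le.2 (Finset.card_erase_lt_of_mem hmem))
  · simp only [Set.InjOn, not_forall] at hinj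
    obtain ⟨y, hy, z, hz, hyz, hne⟩ := hinj
    -- Two fan vertices `y`, `z` miss the same color. Unless a swap helps, both lie in the two-color
    -- component of `x`, which then has three ends.
    let H := twoColorGraph c hc (m x) (m y)
    have hR : ∀ u ∈ R, Missing c u (m y) → H.Reachable x u := by
      intro u hu hub
      by_contra hcon
      obtain ⟨n, hn⟩ := (Finset.mem_filter.1 hu).2
      exact hno (exists_extendsBy_of_not_reachable hc hxy h0 (hm x) hn hub
        (fun h => hcon h.symm))
    have hd1 : ∀ u, Missing c u (m y) → H.degree u ≤ 1 := by
      intro u hu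
      refine degree_twoColorGraph_le hc _ _ u {m x} ?_
      rintro e (rfl | rfl) h
      · simp
      · exact absurd hu h
    refine not_reachable_of_three_ends H ?_ (x := x) (y := y) (z := z)
      (fun h => hxR (h ▸ hy)) (fun h => hxR (h ▸ hz)) hne ?_ (hd1 y (hm y))
      (hd1 z (hyz ▸ hm z)) (hR y hy (hm y)) (hR z hz (hyz ▸ hm z))
    · intro v
      refine (degree_twoColorGraph_le hc _ _ v {m x, m y} ?_).trans Finset.card_le_two
      rintro e (rfl | rfl) h <;> simp
    · refine degree_twoColorGraph_le hc _ _ x {m y} ?_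
      rintro e (rfl | rfl) h
      · exact absurd (hm x) h
      · simp

/-- **Vizing's theorem**: a finite simple graph has a proper edge-coloring with any set of colors
whose size exceeds all degrees. -/
theorem exists_isProperOn_edgeSet [Fintype V] [Fintype K] [Nonempty K] (G : SimpleGraph V)
    [DecidableRel G.Adj] (hG : ∀ v, G.degree v < Fintype.card K) :
    ∃ c : Sym2 V → K, ∀ e ∈ G.edgeSet, ∀ e' ∈ G.edgeSet, e ≠ e' →
      (∃ v, v ∈ e ∧ v ∈ e') → c e ≠ c e' := by
  classical
  have main : ∀ E : Finset (Sym2 V), E ⊆ G.edgeFinset → ∃ c : V → V → Option K,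
      IsPartialColoring c ∧ ∀ v w, c v w ≠ none ↔ s(v, w) ∈ E := by
    intro E
    induction E using Finset.induction_on with
    | empty =>
      exact fun _ => ⟨fun _ _ => none, ⟨fun _ _ => rfl, fun _ => rfl, fun h => by simp at h⟩,
        by simp⟩
    | insert e E he ih =>
      intro hE
      rw [Finset.insert_subset_iff] at hE
      obtain ⟨c, hc, hcE⟩ := ih hE.2
      have hm : ∀ v, ∃ a, Missing c v a := by
        intro v
        by_contra hcon
        simp only [Missing, not_exists, not_forall, not_not] at hcon
        choose g hg using hcon
        refine absurd (hG v) (not_lt.2 ?_)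
        rw [← SimpleGraph.card_neighborFinset_eq_degree, ← Finset.card_univ]
        refine Finset.card_le_card_of_injOn g ?_ ?_
        · intro a _
          have h1 : s(v, g a) ∈ E := (hcE _ _).1 (by simp [hg])
          simpa using hE.2 h1
        · intro a _ b _ h
          refine Option.some_injective _ ?_
          rw [← hg a, ← hg b, h]
      induction e with | _ x y =>
      have hadj : G.Adj x y := by simpa using hE.1
      have h0 : c x y = none := by
        by_contra h
        exact he ((hcE x y).1 h)
      obtain ⟨c', hc', hext⟩ := exists_extendsBy hc hm hadj.ne h0
      refine ⟨c', hc', fun v w => ?_⟩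
      rw [hext v w, hcE, Finset.mem_insert, or_comm]
  obtain ⟨c, hc, hcE⟩ := main _ subset_rfl
  -- The default color is taken only by pairs that are not edges.
  refine ⟨Sym2.lift ⟨fun v w => (c v w).getD (Classical.arbitrary K),
    fun v w => by simp only; rw [hc.symm v w]⟩, ?_⟩
  rintro e he e' he' hne ⟨v, ⟨w, rfl⟩, ⟨w', rfl⟩⟩ h
  simp only [Sym2.lift_mk] at h
  have h1 : c v w ≠ none := (hcE v w).2 (by simpa using he)
  have h2 : c v w' ≠ none := (hcE v w').2 (by simpa using he')
  obtain ⟨a, ha⟩ := Option.ne_none_iff_exists'.1 h1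
  obtain ⟨b, hb⟩ := Option.ne_none_iff_exists'.1 h2
  rw [ha, hb] at h
  simp only [Option.getD_some] at h
  subst h
  exact hne (by rw [hc.inj ha hb])

end Vizing

/-! ### Greedy list coloring -/

theorem exists_greedy_list_coloring {α : Type*} (E : Finset α) (r : α → α → Prop)
    (hr : ∀ e e', r e e' → r e' e) [DecidableEq α] [DecidableRel r] (L : α → Finset ℕ)
    (hL : ∀ e ∈ E, (E.filter fun e' => e' ≠ e ∧ r e e').card < (L e).card) :
    ∃ γ : α → ℕ, (∀ e ∈ E, γ e ∈ L e) ∧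
      ∀ e ∈ E, ∀ e' ∈ E, e ≠ e' → r e e' → γ e ≠ γ e' := by
  induction E using Finset.induction_on with
  | empty => exact ⟨fun _ => 0, by simp, by simp⟩
  | insert a E ha ih =>
    obtain ⟨γ, h1, h2⟩ := ih fun e he => lt_of_le_of_lt
      (Finset.card_le_card (Finset.filter_subset_filter _ (Finset.subset_insert _ _)))
      (hL e (Finset.mem_insert_of_mem he))
    obtain ⟨k, hk, hkE⟩ : ∃ k ∈ L a, k ∉ (E.filter fun e' => r a e').image γ := by
      refine Finset.exists_mem_notMem_of_card_lt_card (lt_of_le_of_lt Finset.card_image_le ?_)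
      refine lt_of_le_of_lt (Finset.card_le_card ?_) (hL a (Finset.mem_insert_self _ _))
      intro e he
      rw [Finset.mem_filter] at he ⊢
      refine ⟨Finset.mem_insert_of_mem he.1, ?_, he.2⟩
      rintro rfl
      exact ha he.1
    have hk' : ∀ e ∈ E, r a e → γ e ≠ k := fun e he hre h =>
      hkE (Finset.mem_image.2 ⟨e, Finset.mem_filter.2 ⟨he, hre⟩, h⟩)
    have hne : ∀ e ∈ E, e ≠ a := fun e he h => ha (h ▸ he)
    refine ⟨Function.update γ a k, fun e he => ?_, fun e he e' he' hee hre => ?_⟩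
    · rcases Finset.mem_insert.1 he with rfl | he
      · simpa using hk
      · rw [Function.update_of_ne (hne e he)]
        exact h1 e he
    · rcases Finset.mem_insert.1 he with rfl | hE <;> rcases Finset.mem_insert.1 he' with rfl | hE'
      · exact absurd rfl hee
      · rw [Function.update_self, Function.update_of_ne (hne e' hE')]
        exact (hk' e' hE' hre).symm
      · rw [Function.update_self, Function.update_of_ne (hne e hE)]
        exact hk' e hE (hr _ _ hre)
      · rw [Function.update_of_ne (hne e hE), Function.update_of_ne (hne e' hE')]
        exact h2 e hE e' hE' hee hre

/-! ### Counting permutations with many prescribed hits -/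

section Permutations

open Classical

variable {ι K : Type*} [Fintype K]

theorem card_perm_fixing (A : Finset K) :
    (Finset.univ.filter fun τ : Equiv.Perm K => ∀ a ∈ A, τ a = a).card
      = (Fintype.card K - A.card).factorial := by
  have e : Equiv.Perm {a // a ∉ A} ≃ {τ : Equiv.Perm K // ∀ a ∈ A, τ a = a} :=
    (Equiv.Perm.subtypeEquivSubtypePerm fun a => a ∉ A).trans
      (Equiv.subtypeEquivRight fun τ => by simp)
  rw [← Fintype.card_subtype, ← Fintype.card_congr e, Fintype.card_perm,
    Fintype.card_subtype_compl, Fintype.card_coe]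

/-- Permutations with the same values on `φ '' T` differ by one fixing that set pointwise, so each
fiber has at most `(|K| - |T|)!` elements; the product counts the possible values. -/
theorem card_perm_mapsTo_le (T : Finset ι) (φ : ι → K) (hφ : Set.InjOn φ T) (S : ι → Finset K) :
    (Finset.univ.filter fun σ : Equiv.Perm K => ∀ i ∈ T, σ (φ i) ∈ S i).card
      ≤ (Fintype.card K - T.card).factorial * ∏ i ∈ T, (S i).card := by
  rw [← Finset.card_pi]
  refine Finset.card_le_mul_card_image_of_maps_to
    (f := fun σ : Equiv.Perm K => fun i (_ : i ∈ T) => σ (φ i)) ?_ _ ?_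
  · intro σ hσ
    simpa using hσ
  · intro b _
    rcases Finset.eq_empty_or_nonempty ((Finset.univ.filter fun σ : Equiv.Perm K =>
      ∀ i ∈ T, σ (φ i) ∈ S i).filter fun σ => (fun i (_ : i ∈ T) => σ (φ i)) = b) with h | ⟨σ₀, h0⟩
    · rw [h]
      simp
    · rw [← Finset.card_image_of_injOn hφ, ← card_perm_fixing]
      refine Finset.card_le_card_of_injOn (fun σ => σ₀⁻¹ * σ) ?_ (mul_right_injective _).injOn
      intro σ hσ
      simp only [Finset.mem_coe, Finset.mem_filter] at hσ h0
      simp only [Finset.mem_coe, Finset.mem_filter, Finset.mem_univ, true_and,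
        Finset.mem_image, forall_exists_index, and_imp]
      rintro _ i hi rfl
      have := congrFun (congrFun (hσ.2.trans h0.2.symm) i) hi
      rw [Equiv.Perm.mul_apply, this, ← Equiv.Perm.mul_apply, inv_mul_cancel,
        Equiv.Perm.one_apply]

/-- Markov's inequality for the `r`-th binomial moment of the number of hits `σ (φ i) ∈ S i` of a
random permutation `σ`. -/
theorem card_perm_many_hits_le (I : Finset ι) (φ : ι → K) (hφ : Set.InjOn φ I)
    (S : ι → Finset K) {s t r : ℕ} (hS : ∀ i ∈ I, (S i).card ≤ s) :
    (Finset.univ.filter fun σ : Equiv.Perm K =>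
        t ≤ (I.filter fun i => σ (φ i) ∈ S i).card).card * t.descFactorial r
      ≤ s ^ r * (Fintype.card K).factorial := by
  have hI : I.card ≤ Fintype.card K := by
    rw [← Finset.card_image_of_injOn hφ]
    exact Finset.card_le_univ _
  rcases lt_or_ge (Fintype.card K) r with hr | hr
  · rcases lt_or_ge t r with ht | ht
    · rw [Nat.descFactorial_eq_zero_iff_lt.2 ht]
      simp
    · rw [Finset.card_eq_zero.2]
      · simp
      · refine Finset.filter_eq_empty_iff.2 fun σ _ h => ?_
        have := Finset.card_filter_le I fun i => σ (φ i) ∈ S i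
        omega
  -- Double counting of pairs `(σ, T)` with `T` an `r`-set of hits of `σ`.
  have hchoose : (Finset.univ.filter fun σ : Equiv.Perm K =>
        t ≤ (I.filter fun i => σ (φ i) ∈ S i).card).card * t.choose r
      ≤ I.card.choose r * ((Fintype.card K - r).factorial * s ^ r) := by
    calc _ ≤ ∑ σ : Equiv.Perm K, ((I.filter fun i => σ (φ i) ∈ S i).card).choose r := by
          rw [← smul_eq_mul, ← Finset.sum_const]
          refine (Finset.sum_le_sum fun σ hσ => ?_).trans
            (Finset.sum_le_sum_of_subset (Finset.filter_subset _ _))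
          exact Nat.choose_le_choose r (Finset.mem_filter.1 hσ).2
      _ ≤ ∑ σ : Equiv.Perm K, ∑ T ∈ I.powersetCard r,
            if ∀ i ∈ T, σ (φ i) ∈ S i then 1 else 0 := by
          refine Finset.sum_le_sum fun σ _ => ?_
          rw [← Finset.card_powersetCard, ← Finset.card_filter]
          refine Finset.card_le_card fun T hT => ?_
          rw [Finset.mem_powersetCard] at hT
          refine Finset.mem_filter.2 ⟨Finset.mem_powersetCard.2
            ⟨hT.1.trans (Finset.filter_subset _ _), hT.2⟩, fun i hi => ?_⟩
          exact (Finset.mem_filter.1 (hT.1 hi)).2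
      _ = ∑ T ∈ I.powersetCard r, (Finset.univ.filter fun σ : Equiv.Perm K =>
            ∀ i ∈ T, σ (φ i) ∈ S i).card := by
          rw [Finset.sum_comm]
          simp only [Finset.card_filter]
      _ ≤ ∑ _T ∈ I.powersetCard r, (Fintype.card K - r).factorial * s ^ r := by
          refine Finset.sum_le_sum fun T hT => ?_
          rw [Finset.mem_powersetCard] at hT
          refine (card_perm_mapsTo_le T φ (hφ.mono (by exact_mod_cast hT.1)) S).trans ?_
          rw [hT.2]
          refine Nat.mul_le_mul_left _ ?_
          rw [← hT.2]
          exact Finset.prod_le_pow_card _ _ _ fun i hi => hS i (hT.1 hi)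
      _ = _ := by
          rw [Finset.sum_const, Finset.card_powersetCard, smul_eq_mul]
  rw [Nat.descFactorial_eq_factorial_mul_choose]
  calc _ = r.factorial * ((Finset.univ.filter fun σ : Equiv.Perm K =>
        t ≤ (I.filter fun i => σ (φ i) ∈ S i).card).card * t.choose r) := by ring
    _ ≤ r.factorial * ((Fintype.card K).choose r * ((Fintype.card K - r).factorial * s ^ r)) :=
        Nat.mul_le_mul_left _ (hchoose.trans (Nat.mul_le_mul_right _ (Nat.choose_le_choose r hI)))
    _ = s ^ r * ((Fintype.card K).choose r * r.factorial * (Fintype.card K - r).factorial) := by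
        ring
    _ = _ := by rw [Nat.choose_mul_factorial_mul_factorial hr]

/-- Finitely many families of at most `2 * q` prescribed values each: some permutation has fewer
than `4 * q` hits in all of them. -/
theorem exists_perm_few_hits {W : Type*} (A : Finset W) (I : W → Finset ι) (φ : W → ι → K)
    (hφ : ∀ w ∈ A, Set.InjOn (φ w) (I w)) (S : W → ι → Finset K) {q : ℕ}
    (hS : ∀ w ∈ A, ∀ i ∈ I w, (S w i).card ≤ 2 * q) (hA : A.card * 2 ^ q < 3 ^ q) :
    ∃ σ : Equiv.Perm K, ∀ w ∈ A, ((I w).filter fun i => σ (φ w i) ∈ S w i).card < 4 * q := by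
  by_contra hcon
  push Not at hcon
  set B : W → Finset (Equiv.Perm K) := fun w => Finset.univ.filter fun σ : Equiv.Perm K =>
        4 * q ≤ ((I w).filter fun i => σ (φ w i) ∈ S w i).card with hB
  have hcover : (Finset.univ : Finset (Equiv.Perm K)) ⊆ A.biUnion B := by
    intro σ _
    obtain ⟨w, hw, h⟩ := hcon σ
    exact Finset.mem_biUnion.2 ⟨w, hw, by simpa [hB] using h⟩
  have hq : 0 < q ^ q := by
    rcases Nat.eq_zero_or_pos q with rfl | h
    · simp
    · positivity
  have hb : ∀ w ∈ A, (B w).card * 3 ^ q ≤ 2 ^ q * (Fintype.card K).factorial := by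
    intro w hw
    have h := card_perm_many_hits_le (I w) (φ w) (hφ w hw) (S w) (t := 4 * q) (r := q) (hS w hw)
    -- Each of the `q` factors of the falling factorial exceeds `4q - q`; the bad fraction is
    -- therefore at most `(2q)^q / (3q)^q`.
    have h2 : (3 * q) ^ q ≤ (4 * q).descFactorial q :=
      (Nat.pow_le_pow_left (by omega) q).trans (Nat.pow_sub_le_descFactorial (4 * q) q)
    have h3 := (Nat.mul_le_mul_left (B w).card h2).trans h
    rw [mul_pow, mul_pow] at h3
    refine Nat.le_of_mul_le_mul_right ?_ hq
    calc _ = (B w).card * (3 ^ q * q ^ q) := by ring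
      _ ≤ _ := h3
      _ = _ := by ring
  have hcard : (Fintype.card K).factorial ≤ ∑ w ∈ A, (B w).card := by
    rw [← Fintype.card_perm, ← Finset.card_univ]
    exact (Finset.card_le_card hcover).trans Finset.card_biUnion_le
  have h1 : (Fintype.card K).factorial * 3 ^ q
      ≤ (Fintype.card K).factorial * (A.card * 2 ^ q) := by
    calc _ ≤ (∑ w ∈ A, (B w).card) * 3 ^ q := Nat.mul_le_mul_right _ hcard
      _ = ∑ w ∈ A, (B w).card * 3 ^ q := Finset.sum_mul _ _ _
      _ ≤ ∑ _w ∈ A, 2 ^ q * (Fintype.card K).factorial := Finset.sum_le_sum hb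
      _ = _ := by
        rw [Finset.sum_const, smul_eq_mul]
        ring
  exact absurd (Nat.le_of_mul_le_mul_left h1 (Nat.factorial_pos _)) (not_le.2 hA)

end Permutations

/-! ### Extending pre-colorings of leaves -/

section Leaves

open Classical

variable {V : Type*}

/-- The colors of the edges in `T` at the vertex `v`. -/
noncomputable def colorsAt (T : Finset (Sym2 V)) (c : Sym2 V → ℕ) (v : V) : Finset ℕ :=
  (T.filter (v ∈ ·)).image c

theorem mem_colorsAt {T : Finset (Sym2 V)} {c : Sym2 V → ℕ} {v : V} {e : Sym2 V} (he : e ∈ T)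
    (hv : v ∈ e) : c e ∈ colorsAt T c v :=
  Finset.mem_image_of_mem c (Finset.mem_filter.2 ⟨he, hv⟩)

theorem card_colorsAt_le (T : Finset (Sym2 V)) (c : Sym2 V → ℕ) (v : V) :
    (colorsAt T c v).card ≤ (T.filter (v ∈ ·)).card :=
  Finset.card_image_le

variable [Fintype V] (G : SimpleGraph V) [DecidableRel G.Adj]

theorem filter_mem_subset_incidenceFinset {T : Finset (Sym2 V)} (hT : T ⊆ G.edgeFinset) (v : V) :
    T.filter (v ∈ ·) ⊆ G.incidenceFinset v := by
  intro e he
  rw [Finset.mem_filter] at he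
  rw [SimpleGraph.mem_incidenceFinset]
  exact ⟨by simpa using hT he.1, he.2⟩

variable {P : Finset (Sym2 V)} {c₀ : Sym2 V → ℕ}

/-- The vertices with more than `q` pre-colored leaves. -/
noncomputable def bigVertices (P : Finset (Sym2 V)) (c₀ : Sym2 V → ℕ) (q : ℕ) : Finset V :=
  Finset.univ.filter fun v => q < (colorsAt P c₀ v).card

theorem notMem_bigVertices {q : ℕ} {v : V} :
    v ∉ bigVertices P c₀ q ↔ (colorsAt P c₀ v).card ≤ q := by
  simp [bigVertices]

/-- Each leaf has an end of degree 1, which is not big since `q ≥ 1`. So a leaf is counted at most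
once over the big vertices, each of which needs `q + 1` leaves. -/
theorem card_bigVertices_le (hP : ∀ e ∈ P, IsLeafEdge G e) {d q : ℕ} (hPd : P.card ≤ d)
    (hdq : d < (q + 1) ^ 2) (hq : 1 ≤ q) : (bigVertices P c₀ q).card ≤ q := by
  have hPG : P ⊆ G.edgeFinset := fun e he => by simpa using (hP e he).1
  set B := bigVertices P c₀ q with hB
  have h1 : B.card * (q + 1) ≤ ∑ v ∈ B, (P.filter (v ∈ ·)).card := by
    rw [← smul_eq_mul, ← Finset.sum_const]
    refine Finset.sum_le_sum fun v hv => ?_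
    exact (Finset.mem_filter.1 hv).2.trans_le (card_colorsAt_le _ _ _)
  have h2 : ∑ v ∈ B, (P.filter (v ∈ ·)).card ≤ P.card := by
    simp only [Finset.card_filter]
    rw [Finset.sum_comm, Finset.card_eq_sum_ones]
    refine Finset.sum_le_sum fun e he => ?_
    rw [← Finset.card_filter]
    obtain ⟨-, l, ⟨w, rfl⟩, hl⟩ := hP e he
    have hlB : l ∉ B := by
      rw [hB, notMem_bigVertices]
      refine (card_colorsAt_le _ _ _).trans ?_
      refine (Finset.card_le_card (filter_mem_subset_incidenceFinset G hPG l)).trans ?_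
      rw [SimpleGraph.card_incidenceFinset_eq_degree, hl]
      exact hq
    refine (Finset.card_le_card (t := {w}) fun v hv => ?_).trans (Finset.card_singleton w).le
    rw [Finset.mem_filter, Sym2.mem_iff] at hv
    rcases hv.2 with rfl | rfl
    · exact absurd hv.1 hlB
    · simp
  by_contra hcon
  have : (q + 1) * (q + 1) ≤ B.card * (q + 1) := Nat.mul_le_mul_right _ (by omega)
  nlinarith

/-- The edges outside `P` that join `B` to its complement. -/
noncomputable def crossEdges (P : Finset (Sym2 V)) (B : Finset V) : Finset (Sym2 V) :=
  G.edgeFinset.filter fun e => e ∉ P ∧ (∃ v ∈ e, v ∈ B) ∧ ∃ w ∈ e, w ∉ B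

theorem card_crossEdges_filter_le (P : Finset (Sym2 V)) (B : Finset V) {w : V} (hw : w ∉ B) :
    ((crossEdges G P B).filter (w ∈ ·)).card ≤ B.card := by
  refine (Finset.card_le_card (t := B.image fun b => s(w, b)) fun e he => ?_).trans
    Finset.card_image_le
  rw [Finset.mem_filter] at he
  obtain ⟨he, x, rfl⟩ := he
  obtain ⟨-, -, ⟨v, hv, hvB⟩, -⟩ := Finset.mem_filter.1 he
  rcases Sym2.mem_iff.1 hv with rfl | rfl
  · exact absurd hvB hw
  · exact Finset.mem_image_of_mem _ hvB

/-- For a cross edge `v w` with `v ∈ B`, the leaves and other cross edges at `v` block at most `d -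
1` colors, the leaves at `w` at most `q`, and the other cross edges at `w` at most `q - 1`: fewer
than `d + 2q` in all. -/
theorem exists_coloring_crossEdges {d q : ℕ} (hG : ∀ v, G.degree v ≤ d)
    (hP : P ⊆ G.edgeFinset) (B : Finset V) (hB : B.card ≤ q)
    (hS : ∀ w, w ∉ B → (colorsAt P c₀ w).card ≤ q) (Q : Finset ℕ) (hQ : Q.card = d + 2 * q) :
    ∃ γ : Sym2 V → ℕ, (∀ e ∈ crossEdges G P B, γ e ∈ Q ∧ ∀ v ∈ e, γ e ∉ colorsAt P c₀ v) ∧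
      IsProperOn (crossEdges G P B : Set (Sym2 V)) γ := by
  set E := crossEdges G P B with hE
  have hlist : ∀ e ∈ E, (E.filter fun e' => e' ≠ e ∧ ∃ v, v ∈ e ∧ v ∈ e').card <
      (Q.filter fun k => ∀ v ∈ e, k ∉ colorsAt P c₀ v).card := by
    intro e he
    have he0 := he
    obtain ⟨heG, heP, ⟨v, hv, hvB⟩, ⟨w, hw, hwB⟩⟩ := Finset.mem_filter.1 he
    have hvw : v ≠ w := fun h => hwB (h ▸ hvB)
    obtain rfl : e = s(v, w) := (Sym2.mem_and_mem_iff hvw).1 ⟨hv, hw⟩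
    have hL : Q.card - ((colorsAt P c₀ v).card + (colorsAt P c₀ w).card) ≤
        (Q.filter fun k => ∀ u ∈ s(v, w), k ∉ colorsAt P c₀ u).card := by
      refine (Nat.sub_le_sub_left (Finset.card_union_le _ _) _).trans ?_
      refine (Finset.le_card_sdiff _ _).trans (Finset.card_le_card fun k hk => ?_)
      rw [Finset.mem_sdiff, Finset.mem_union, not_or] at hk
      refine Finset.mem_filter.2 ⟨hk.1, fun u hu => ?_⟩
      rcases Sym2.mem_iff.1 hu with rfl | rfl
      · exact hk.2.1
      · exact hk.2.2
    have hsub : (E.filter fun e' => e' ≠ s(v, w) ∧ ∃ u, u ∈ s(v, w) ∧ u ∈ e') ⊆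
        (G.incidenceFinset v \ P.filter (v ∈ ·)).erase s(v, w) ∪
          (E.filter (w ∈ ·)).erase s(v, w) := by
      intro e' he'
      obtain ⟨he'E, hne, u, hu, hu'⟩ := Finset.mem_filter.1 he'
      obtain ⟨he'G, he'P, -⟩ := Finset.mem_filter.1 he'E
      rw [Finset.mem_union, Finset.mem_erase, Finset.mem_erase]
      rcases Sym2.mem_iff.1 hu with rfl | rfl
      · refine Or.inl ⟨hne, Finset.mem_sdiff.2 ⟨?_, fun h => he'P (Finset.mem_filter.1 h).1⟩⟩
        rw [SimpleGraph.mem_incidenceFinset]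
        exact ⟨by simpa using he'G, hu'⟩
      · exact Or.inr ⟨hne, Finset.mem_filter.2 ⟨he'E, hu'⟩⟩
    have hcard := (Finset.card_le_card hsub).trans (Finset.card_union_le _ _)
    have hmem1 : s(v, w) ∈ G.incidenceFinset v \ P.filter (v ∈ ·) := by
      refine Finset.mem_sdiff.2 ⟨?_, fun h => heP (Finset.mem_filter.1 h).1⟩
      rw [SimpleGraph.mem_incidenceFinset]
      exact ⟨by simpa using heG, hv⟩
    have hmem2 : s(v, w) ∈ E.filter (w ∈ ·) := Finset.mem_filter.2 ⟨he0, hw⟩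
    rw [Finset.card_erase_of_mem hmem1, Finset.card_erase_of_mem hmem2,
      Finset.card_sdiff_of_subset (filter_mem_subset_incidenceFinset G hP v),
      SimpleGraph.card_incidenceFinset_eq_degree] at hcard
    have hp1 := Finset.card_pos.2 ⟨_, hmem1⟩
    have hp2 := Finset.card_pos.2 ⟨_, hmem2⟩
    rw [Finset.card_sdiff_of_subset (filter_mem_subset_incidenceFinset G hP v),
      SimpleGraph.card_incidenceFinset_eq_degree] at hp1
    have h3 := card_crossEdges_filter_le G P B hwB
    have h4 := hG v
    have h5 := hS w hwB
    have h6 := card_colorsAt_le P c₀ v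
    have h7 : (E.filter (w ∈ ·)).card ≤ B.card := h3
    omega
  obtain ⟨γ, h1, h2⟩ := exists_greedy_list_coloring E (fun e e' => ∃ v, v ∈ e ∧ v ∈ e')
    (fun e e' ⟨v, h, h'⟩ => ⟨v, h', h⟩) _ hlist
  exact ⟨γ, fun e he => Finset.mem_filter.1 (h1 e he),
    fun e he e' he' hne hr => h2 e he e' he' hne hr⟩

/-- A proper edge-coloring with colors from `Q` of a graph `H` in which few edges at any vertex
have a color that is forbidden at the other end. -/
theorem exists_coloring_few_conflicts (H : SimpleGraph V) {d q m : ℕ}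
    (hH : ∀ v, H.degree v ≤ d) (S : V → Finset ℕ) (hS : ∀ u v, H.Adj u v → (S v).card ≤ 2 * q)
    (hm : (Finset.univ.filter fun u => (∃ v, H.Adj u v) ∧ (S u).Nonempty).card ≤ m)
    (hq : 1 ≤ q) (hmq : m * d * 2 ^ q < 3 ^ q) (Q : Finset ℕ) (hQ : d < Q.card) :
    ∃ φ : Sym2 V → ℕ, (∀ e, φ e ∈ Q) ∧ IsProperOn H.edgeSet φ ∧
      ∀ v, ((H.neighborFinset v).filter fun u => φ s(v, u) ∈ S u).card < 4 * q := by
  have hne : Nonempty Q := (Finset.card_pos.1 (by omega : 0 < Q.card)).to_subtype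
  obtain ⟨φ, hφ⟩ := exists_isProperOn_edgeSet (K := Q) H fun v => by
    rw [Fintype.card_coe]
    exact (hH v).trans_lt hQ
  set U := Finset.univ.filter fun u => (∃ v, H.Adj u v) ∧ (S u).Nonempty with hU
  -- Only neighbors of vertices with a nonempty forbidden set can see a conflict, so the union bound
  -- does not depend on the size of `V`.
  set A := U.biUnion fun u => H.neighborFinset u with hA
  have hAm : A.card ≤ m * d :=
    (Finset.card_biUnion_le_card_mul _ _ d fun u _ => by
      rw [SimpleGraph.card_neighborFinset_eq_degree]
      exact hH u).trans (Nat.mul_le_mul_right _ hm)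
  -- Permuting color names keeps the coloring proper; properness at `v` is what makes the colors on
  -- its edges injective.
  obtain ⟨σ, hσ⟩ := exists_perm_few_hits A (fun v => H.neighborFinset v)
    (fun v u => φ s(v, u)) (q := q) (fun v _ u hu u' hu' h => by
      by_contra hne
      simp only [SimpleGraph.coe_neighborFinset, SimpleGraph.mem_neighborSet] at hu hu'
      exact hφ s(v, u) hu s(v, u') hu' (fun h => hne (Sym2.congr_right.1 h))
        ⟨v, by simp, by simp⟩ h)
    (fun _ u => Finset.univ.filter fun k : Q => k.1 ∈ S u)
    (fun v _ u hu => by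
      rw [SimpleGraph.mem_neighborFinset] at hu
      refine (Finset.card_le_card_of_injOn Subtype.val (fun k hk => ?_)
        Subtype.val_injective.injOn).trans (hS v u hu)
      exact (Finset.mem_filter.1 hk).2)
    ((Nat.mul_le_mul_right _ hAm).trans_lt hmq)
  refine ⟨fun e => (σ (φ e)).1, fun e => (σ (φ e)).2, fun e he e' he' hne hr h => ?_, fun v => ?_⟩
  · exact hφ e he e' he' hne hr (σ.injective (Subtype.ext h))
  · by_cases hv : v ∈ A
    · simpa using hσ v hv
    · rw [Finset.filter_eq_empty_iff.2]
      · simp only [Finset.card_empty]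
        omega
      · intro u hu hmem
        rw [SimpleGraph.mem_neighborFinset] at hu
        refine hv (Finset.mem_biUnion.2 ⟨u, ?_, by simpa using hu.symm⟩)
        exact Finset.mem_filter.2 ⟨Finset.mem_univ _, ⟨v, hu.symm⟩, _, hmem⟩

end Leaves

/-! ### Assembling the extension and repairing the conflicts. -/

section Extension

open Classical

variable {V : Type*} [Fintype V] (G : SimpleGraph V) [DecidableRel G.Adj]
  {P : Finset (Sym2 V)} {c₀ : Sym2 V → ℕ}

theorem exists_extension_of_card_le {d q : ℕ} (hG : ∀ v, G.degree v ≤ d)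
    (hdq : d < (q + 1) ^ 2) (hq : 1 ≤ q) (hd3 : (q + 2) * d * d * 2 ^ q < 3 ^ q)
    (hP : ∀ e ∈ P, IsLeafEdge G e) (hPd : P.card ≤ d) (hc₀ : IsProperOn (P : Set (Sym2 V)) c₀) :
    ∃ c : Sym2 V → ℕ, IsProperOn G.edgeSet c ∧ (∀ e ∈ P, c e = c₀ e) ∧
      (c '' G.edgeSet).ncard ≤ d + 8 * q := by
  have hPG : P ⊆ G.edgeFinset := fun e he => by simpa using (hP e he).1
  obtain ⟨Q, hPQ, hQ⟩ := Infinite.exists_superset_card_eq (P.image c₀) (d + 2 * q)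
    (Finset.card_image_le.trans (by omega))
  obtain ⟨Q', hQQ', hQ'⟩ := Infinite.exists_superset_card_eq Q (d + 8 * q) (by omega)
  set B := bigVertices P c₀ q with hBdef
  have hB : B.card ≤ q := card_bigVertices_le G hP hPd hdq hq
  obtain ⟨γ, hγ, hγE⟩ := exists_coloring_crossEdges (c₀ := c₀) G hG hPG B hB
    (fun w hw => notMem_bigVertices.1 hw) Q hQ
  set E := crossEdges G P B with hE
  have hEG : E ⊆ G.edgeFinset := Finset.filter_subset _ _
  let S : V → Finset ℕ := fun v => colorsAt P c₀ v ∪ colorsAt E γ v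
  have hS : ∀ v, v ∉ B → (S v).card ≤ 2 * q := by
    intro v hv
    have h1 := Finset.card_union_le (colorsAt P c₀ v) (colorsAt E γ v)
    have h2 := notMem_bigVertices.1 hv
    have h3 := (card_colorsAt_le E γ v).trans (card_crossEdges_filter_le G P B hv)
    change (colorsAt P c₀ v ∪ colorsAt E γ v).card ≤ 2 * q
    omega
  obtain ⟨H, hH⟩ : ∃ H : SimpleGraph V, ∀ v w, H.Adj v w ↔
      G.Adj v w ∧ s(v, w) ∉ P ∧ v ∉ B ∧ w ∉ B :=
    ⟨{ Adj := fun v w => G.Adj v w ∧ s(v, w) ∉ P ∧ v ∉ B ∧ w ∉ B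
       symm := ⟨fun v w h => ⟨h.1.symm, by rw [Sym2.eq_swap]; exact h.2.1, h.2.2.2, h.2.2.1⟩⟩
       loopless := ⟨fun v h => h.1.ne rfl⟩ }, fun _ _ => Iff.rfl⟩
  have hHG : H ≤ G := fun v w h => ((hH v w).1 h).1
  have hHd : ∀ v, H.degree v ≤ d := fun v => (SimpleGraph.degree_le_of_le hHG).trans (hG v)
  have hU : (Finset.univ.filter fun u => (∃ v, H.Adj u v) ∧ (S u).Nonempty).card
      ≤ (q + 2) * d := by
    refine (Finset.card_le_card (t := P.biUnion Sym2.toFinset ∪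
      B.biUnion fun b => G.neighborFinset b) fun u hu => ?_).trans
      ((Finset.card_union_le _ _).trans ?_)
    · obtain ⟨-, ⟨v, hv⟩, k, hk⟩ := Finset.mem_filter.1 hu
      have huB : u ∉ B := ((hH u v).1 hv).2.2.1
      rcases Finset.mem_union.1 hk with hk | hk
      · obtain ⟨e, he, -⟩ := Finset.mem_image.1 hk
        rw [Finset.mem_filter] at he
        exact Finset.mem_union_left _ (Finset.mem_biUnion.2 ⟨e, he.1, by simpa using he.2⟩)
      · obtain ⟨e, he, -⟩ := Finset.mem_image.1 hk
        rw [Finset.mem_filter] at he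
        obtain ⟨he, hue⟩ := he
        obtain ⟨heG, -, ⟨b, hbe, hb⟩, -⟩ := Finset.mem_filter.1 he
        have hbu : b ≠ u := fun h => huB (h ▸ hb)
        rw [(Sym2.mem_and_mem_iff hbu).1 ⟨hbe, hue⟩] at heG
        exact Finset.mem_union_right _ (Finset.mem_biUnion.2 ⟨b, hb, by simpa using heG⟩)
    · have h1 : (P.biUnion Sym2.toFinset).card ≤ P.card * 2 :=
        Finset.card_biUnion_le_card_mul _ _ 2 fun e _ => by
          rw [Sym2.card_toFinset]
          split_ifs <;> omega
      have h2 : (B.biUnion fun b => G.neighborFinset b).card ≤ B.card * d :=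
        Finset.card_biUnion_le_card_mul _ _ d fun b _ => by
          rw [SimpleGraph.card_neighborFinset_eq_degree]
          exact hG b
      have h3 : B.card * d ≤ q * d := Nat.mul_le_mul_right _ hB
      rw [Nat.add_mul]
      omega
  obtain ⟨φ, hφQ, hφ, hφc⟩ := exists_coloring_few_conflicts H hHd S
    (fun u v h => hS v ((hH u v).1 h).2.2.2) hU hq hd3 Q (by omega)
  -- `F` collects what remains for the fresh colors: edges inside `B` and conflicting edges outside
  -- it. The two kinds share no vertex.
  obtain ⟨F, hF⟩ : ∃ F : SimpleGraph V, ∀ v w, F.Adj v w ↔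
      G.Adj v w ∧ s(v, w) ∉ P ∧ ((v ∈ B ∧ w ∈ B) ∨
        (v ∉ B ∧ w ∉ B ∧ (φ s(v, w) ∈ S v ∨ φ s(v, w) ∈ S w))) :=
    ⟨{ Adj := fun v w => G.Adj v w ∧ s(v, w) ∉ P ∧ ((v ∈ B ∧ w ∈ B) ∨
         (v ∉ B ∧ w ∉ B ∧ (φ s(v, w) ∈ S v ∨ φ s(v, w) ∈ S w)))
       symm := ⟨fun v w h => by
         rw [Sym2.eq_swap] at h
         exact ⟨h.1.symm, h.2.1, h.2.2.imp And.symm fun h => ⟨h.2.1, h.1, h.2.2.symm⟩⟩⟩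
       loopless := ⟨fun v h => h.1.ne rfl⟩ }, fun _ _ => Iff.rfl⟩
  have hFd : ∀ v, F.degree v < 6 * q := by
    intro v
    rw [← SimpleGraph.card_neighborFinset_eq_degree]
    by_cases hv : v ∈ B
    · refine lt_of_le_of_lt (Finset.card_le_card (t := B) fun w hw => ?_) (by omega)
      rw [SimpleGraph.mem_neighborFinset, hF] at hw
      rcases hw.2.2 with h | h
      · exact h.2
      · exact absurd hv h.1
    -- At `v` outside `B`, at most `2q` edges conflict at `v` itself and fewer than `4q` at the
    -- other end.
    · have h1 : ((H.neighborFinset v).filter fun u => φ s(v, u) ∈ S v).card ≤ (S v).card := by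
        refine Finset.card_le_card_of_injOn (fun u => φ s(v, u))
          (fun u hu => (Finset.mem_filter.1 hu).2) ?_
        intro u hu u' hu' h
        by_contra hne
        have hu1 := (Finset.mem_filter.1 hu).1
        have hu2 := (Finset.mem_filter.1 hu').1
        rw [SimpleGraph.mem_neighborFinset] at hu1 hu2
        exact hφ s(v, u) hu1 s(v, u') hu2 (fun h => hne (Sym2.congr_right.1 h))
          ⟨v, by simp, by simp⟩ h
      have h2 := Finset.card_le_card (s := F.neighborFinset v)
        (t := ((H.neighborFinset v).filter fun u => φ s(v, u) ∈ S v) ∪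
          ((H.neighborFinset v).filter fun u => φ s(v, u) ∈ S u)) (fun u hu => by
            rw [SimpleGraph.mem_neighborFinset, hF] at hu
            obtain ⟨h1, h2, h3⟩ := hu
            rcases h3 with h3 | ⟨h3, h4, h5⟩
            · exact absurd h3.1 hv
            · have hHvu : H.Adj v u := (hH v u).2 ⟨h1, h2, h3, h4⟩
              simp only [Finset.mem_union, Finset.mem_filter, SimpleGraph.mem_neighborFinset]
              exact h5.imp (⟨hHvu, ·⟩) (⟨hHvu, ·⟩))
      have h3 := h2.trans (Finset.card_union_le _ _)
      have h4 := hS v hv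
      have h5 := hφc v
      omega
  have hR : (Q' \ Q).card = 6 * q := by
    rw [Finset.card_sdiff_of_subset hQQ']
    omega
  have hRne : Nonempty ↥(Q' \ Q) := (Finset.card_pos.1 (by omega : 0 < (Q' \ Q).card)).to_subtype
  obtain ⟨ψ, hψ⟩ := exists_isProperOn_edgeSet (K := ↥(Q' \ Q)) F fun v => by
    rw [Fintype.card_coe, hR]
    exact hFd v
  let c : Sym2 V → ℕ := fun e => if e ∈ P then c₀ e else if e ∈ E then γ e else
    if e ∈ F.edgeSet then (ψ e).1 else φ e
  -- An edge left with its color `φ e` has both ends outside `B` and conflicts at neither end.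
  have hclass : ∀ e ∈ G.edgeSet, (e ∈ P ∧ c e = c₀ e) ∨ (e ∈ E ∧ c e = γ e) ∨
      (e ∈ F.edgeSet ∧ c e = (ψ e).1) ∨
      (e ∈ H.edgeSet ∧ c e = φ e ∧ ∀ v ∈ e, φ e ∉ S v) := by
    intro e he
    by_cases h1 : e ∈ P
    · exact Or.inl ⟨h1, if_pos h1⟩
    by_cases h2 : e ∈ E
    · exact Or.inr (Or.inl ⟨h2, by simp only [c, if_neg h1, if_pos h2]⟩)
    by_cases h3 : e ∈ F.edgeSet
    · exact Or.inr (Or.inr (Or.inl ⟨h3, by simp only [c, if_neg h1, if_neg h2, if_pos h3]⟩))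
    refine Or.inr (Or.inr (Or.inr ⟨?_, by simp only [c, if_neg h1, if_neg h2, if_neg h3], ?_⟩))
    all_goals
      have h4 : ¬ ((∃ v ∈ e, v ∈ B) ∧ ∃ w ∈ e, w ∉ B) := fun h =>
        h2 (Finset.mem_filter.2 ⟨by simpa using he, h1, h⟩)
      induction e with | _ x y =>
      simp only [SimpleGraph.mem_edgeSet, hF, hH, Sym2.mem_iff, exists_eq_or_imp, exists_eq_left,
        forall_eq_or_imp, forall_eq] at he h3 h4 ⊢
      clear * - he h1 h3 h4
      tauto
  have hPE : ∀ e ∈ P, ∀ e' ∈ E, (∃ v, v ∈ e ∧ v ∈ e') → c₀ e ≠ γ e' := by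
    rintro e he e' he' ⟨v, hv, hv'⟩ h
    exact (hγ e' he').2 v hv' (h ▸ mem_colorsAt he hv)
  have hPS : ∀ e ∈ P, ∀ v ∈ e, c₀ e ∈ S v := fun e he v hv =>
    Finset.mem_union_left _ (mem_colorsAt he hv)
  have hES : ∀ e ∈ E, ∀ v ∈ e, γ e ∈ S v := fun e he v hv =>
    Finset.mem_union_right _ (mem_colorsAt he hv)
  have hPQ' : ∀ e ∈ P, c₀ e ∈ Q := fun e he => hPQ (Finset.mem_image_of_mem _ he)
  have hEQ : ∀ e ∈ E, γ e ∈ Q := fun e he => (hγ e he).1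
  have hψQ : ∀ e, (ψ e).1 ∉ Q := fun e => (Finset.mem_sdiff.1 (ψ e).2).2
  have hψQ' : ∀ e, (ψ e).1 ∈ Q' := fun e => (Finset.mem_sdiff.1 (ψ e).2).1
  refine ⟨c, ?_, fun e he => if_pos he, ?_⟩
  · intro e he e' he' hne hr h
    have hr' : ∃ v, v ∈ e' ∧ v ∈ e := hr.imp fun v hv => hv.symm
    rcases hclass e he with ⟨h1, h2⟩ | ⟨h1, h2⟩ | ⟨h1, h2⟩ | ⟨h1, h2, h3⟩ <;>
    rcases hclass e' he' with ⟨h1', h2'⟩ | ⟨h1', h2'⟩ | ⟨h1', h2'⟩ | ⟨h1', h2', h3'⟩ <;>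
    rw [h2, h2'] at h
    · exact hc₀ e h1 e' h1' hne hr h
    · exact hPE e h1 e' h1' hr h
    · exact hψQ e' (h ▸ hPQ' e h1)
    · obtain ⟨v, hv, hv'⟩ := hr
      exact h3' v hv' (h ▸ hPS e h1 v hv)
    · exact hPE e' h1' e h1 hr' h.symm
    · exact hγE e h1 e' h1' hne hr h
    · exact hψQ e' (h ▸ hEQ e h1)
    · obtain ⟨v, hv, hv'⟩ := hr
      exact h3' v hv' (h ▸ hES e h1 v hv)
    · exact hψQ e (h ▸ hPQ' e' h1')
    · exact hψQ e (h ▸ hEQ e' h1')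
    · exact hψ e h1 e' h1' hne hr (Subtype.ext h)
    · exact hψQ e (h ▸ hφQ e')
    · obtain ⟨v, hv, hv'⟩ := hr
      exact h3 v hv (h ▸ hPS e' h1' v hv')
    · obtain ⟨v, hv, hv'⟩ := hr
      exact h3 v hv (h ▸ hES e' h1' v hv')
    · exact hψQ e' (h ▸ hφQ e)
    · exact hφ e h1 e' h1' hne hr h
  · rw [← hQ', ← Set.ncard_coe_finset]
    refine Set.ncard_le_ncard ?_ (Finset.finite_toSet _)
    rintro _ ⟨e, he, rfl⟩
    rcases hclass e he with ⟨h1, h2⟩ | ⟨h1, h2⟩ | ⟨h1, h2⟩ | ⟨h1, h2, h3⟩ <;> rw [h2]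
    · exact hQQ' (hPQ' e h1)
    · exact hQQ' (hEQ e h1)
    · exact hψQ' e
    · exact hQQ' (hφQ e)

/-- Coloring everything outside `P` with fresh colors. -/
theorem exists_extension_fresh {d m : ℕ} (hG : ∀ v, G.degree v ≤ d)
    (hPm : P.card ≤ m) (hc₀ : IsProperOn (P : Set (Sym2 V)) c₀) :
    ∃ c : Sym2 V → ℕ, IsProperOn G.edgeSet c ∧ (∀ e ∈ P, c e = c₀ e) ∧
      (c '' G.edgeSet).ncard ≤ m + d + 1 := by
  obtain ⟨Q', hPQ, hQ'⟩ := Infinite.exists_superset_card_eq (P.image c₀)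
    ((P.image c₀).card + (d + 1)) (by omega)
  have hR : (Q' \ P.image c₀).card = d + 1 := by
    rw [Finset.card_sdiff_of_subset hPQ]
    omega
  have hRne : Nonempty ↥(Q' \ P.image c₀) :=
    (Finset.card_pos.1 (by omega : 0 < (Q' \ P.image c₀).card)).to_subtype
  obtain ⟨ψ, hψ⟩ := exists_isProperOn_edgeSet (K := ↥(Q' \ P.image c₀)) G fun v => by
    rw [Fintype.card_coe, hR]
    exact Nat.lt_succ_of_le (hG v)
  have hψ' := fun e => Finset.mem_sdiff.1 (ψ e).2
  have hP := fun e (he : e ∈ P) => Finset.mem_image_of_mem c₀ he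
  refine ⟨fun e => if e ∈ P then c₀ e else (ψ e).1, ?_, fun e he => if_pos he, ?_⟩
  · intro e he e' he' hne hr
    simp only
    split_ifs with h1 h2 h2
    · exact hc₀ e h1 e' h2 hne hr
    · exact fun h => (hψ' e').2 (h ▸ hP e h1)
    · exact fun h => (hψ' e).2 (h ▸ hP e' h2)
    · exact fun h => hψ e he e' he' hne hr (Subtype.ext h)
  · have h1 : ((fun e => if e ∈ P then c₀ e else (ψ e).1) '' G.edgeSet).ncard ≤ Q'.card := by
      rw [← Set.ncard_coe_finset]
      refine Set.ncard_le_ncard ?_ (Finset.finite_toSet _)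
      rintro _ ⟨e, he, rfl⟩
      simp only
      split_ifs with h1
      · exact hPQ (hP e h1)
      · exact (hψ' e).1
    have h2 := Finset.card_image_le (s := P) (f := c₀)
    omega

end Extension

/-! ### Asymptotics -/

theorem exists_forall_sqrt_large : ∃ N : ℕ, 1 ≤ N ∧ ∀ q : ℕ, N ≤ q → ∀ d : ℕ, d < (q + 1) ^ 2 →
    (q + 2) * d * d * 2 ^ q < 3 ^ q := by
  have h := tendsto_pow_const_mul_const_pow_of_abs_lt_one 5 (r := (2 / 3 : ℝ))
    (by rw [abs_of_pos] <;> norm_num)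
  -- The 27 comes from `q + 2 ≤ 3q` and, twice, `d ≤ q² + 2q ≤ 3q²`.
  have h2 := h.eventually_lt_const (show (0 : ℝ) < 1 / 27 by norm_num)
  obtain ⟨N, hN⟩ := Filter.eventually_atTop.1 h2
  refine ⟨max N 1, le_max_right _ _, fun q hq d hd => ?_⟩
  have hq1 : 1 ≤ q := (le_max_right _ _).trans hq
  have h3 := hN q ((le_max_left _ _).trans hq)
  rw [div_pow, mul_div_assoc', div_lt_iff₀ (by positivity)] at h3
  have h4 : 27 * (q ^ 5 * 2 ^ q) < 3 ^ q := by
    have : (27 : ℝ) * ((q : ℝ) ^ 5 * 2 ^ q) < 3 ^ q := by linarith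
    exact_mod_cast this
  have hd' : d ≤ 3 * q ^ 2 := by nlinarith
  calc (q + 2) * d * d * 2 ^ q ≤ (3 * q) * (3 * q ^ 2) * (3 * q ^ 2) * 2 ^ q := by
        gcongr
        omega
    _ = 27 * (q ^ 5 * 2 ^ q) := by ring
    _ < 3 ^ q := h4

theorem exists_forall_leafPrecoloringsExtend : ∃ D : ℕ, ∀ d : ℕ, D ≤ d →
    ∀ (V : Type*) [Fintype V] (G : SimpleGraph V) [DecidableRel G.Adj],
      (∀ v, G.degree v ≤ d) → LeafPrecoloringsExtend G d ((d : ℝ) + 9 * Real.sqrt (d : ℝ)) := by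
  obtain ⟨N, hN1, hN⟩ := exists_forall_sqrt_large
  refine ⟨N ^ 2, fun d hd V _ G _ hG P c₀ hP hPd hc₀ => ?_⟩
  have hNq : N ≤ Nat.sqrt d := Nat.le_sqrt'.2 hd
  obtain ⟨c, h1, h2, h3⟩ := exists_extension_of_card_le G hG (Nat.lt_succ_sqrt' d)
    (hN1.trans hNq) (hN _ hNq d (Nat.lt_succ_sqrt' d)) hP hPd hc₀
  refine ⟨c, h1, h2, ?_⟩
  have h4 : ((c '' G.edgeSet).ncard : ℝ) ≤ d + 8 * (Nat.sqrt d : ℕ) := by exact_mod_cast h3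
  have h5 : ((Nat.sqrt d : ℕ) : ℝ) ≤ Real.sqrt d := Real.nat_sqrt_le_real_sqrt
  have h6 := Real.sqrt_nonneg (d : ℝ)
  linarith

theorem LeafPrecoloringsExtend.mono {V : Type*} [Fintype V] {G : SimpleGraph V}
    [DecidableRel G.Adj] {m m' : ℕ} {N N' : ℝ} (h : LeafPrecoloringsExtend G m N) (hm : m' ≤ m)
    (hN : N ≤ N') : LeafPrecoloringsExtend G m' N' := by
  intro P c₀ hP hPm hc₀
  obtain ⟨c, h1, h2, h3⟩ := h P c₀ hP (hPm.trans hm) hc₀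
  exact ⟨c, h1, h2, h3.trans hN⟩

theorem exists_forall_mem_admissible : ∃ D : ℕ, ∀ (k : ℕ) (g : ℤ),
    9 * Real.sqrt (k + 1) + 1 + D ≤ g → g ∈ admissible k := by
  obtain ⟨D, hD⟩ := exists_forall_leafPrecoloringsExtend.{0}
  refine ⟨D, fun k g hg d hd1 hdk V _ G _ hG _ => ?_⟩
  have hD0 : (0 : ℝ) ≤ D := Nat.cast_nonneg D
  -- For `d + 1 ≥ D` the large-degree bound is applied to `d + 1`. Otherwise fresh colors give at
  -- most `(d - 1) + (d + 1) + 1 ≤ d + (D + 1)`.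
  rcases le_or_gt D (d + 1) with h | h
  · refine (hD (d + 1) h V G hG).mono (by omega) ?_
    have : Real.sqrt ((d + 1 : ℕ) : ℝ) ≤ Real.sqrt (k + 1) := by
      apply Real.sqrt_le_sqrt
      exact_mod_cast Nat.succ_le_succ hdk
    push_cast at this ⊢
    linarith
  · intro P c₀ hP hPd hc₀
    obtain ⟨c, h1, h2, h3⟩ := exists_extension_fresh G hG hPd hc₀
    refine ⟨c, h1, h2, ?_⟩
    have h4 : (c '' G.edgeSet).ncard ≤ d + (D + 1) := by omega
    have h5 : ((c '' G.edgeSet).ncard : ℝ) ≤ d + (D + 1) := by exact_mod_cast h4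
    have h6 := Real.sqrt_nonneg ((k : ℝ) + 1)
    linarith

/-- A single edge with `d = 1` already needs one color. This bounds the admissible set below, so its
infimum is attained. -/
theorem nonneg_of_mem_admissible {k : ℕ} (hk : 1 ≤ k) {g : ℤ} (hg : g ∈ admissible k) :
    0 ≤ g := by
  have hdeg : ∀ v, (⊤ : SimpleGraph (Fin 2)).degree v = 1 := fun v => by simp
  obtain ⟨c, -, -, h⟩ := hg 1 le_rfl hk (Fin 2) ⊤ (fun v => by rw [hdeg]; norm_num)
    (fun v w h => by rw [hdeg] at h; omega) ∅ (fun _ => 0) (by simp) (by simp)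
    (by simp [IsProperOn])
  have h1 : 0 < (c '' (⊤ : SimpleGraph (Fin 2)).edgeSet).ncard := by
    rw [Set.ncard_pos (Set.toFinite _)]
    exact ⟨c s(0, 1), Set.mem_image_of_mem c (by simp)⟩
  have h2 : (1 : ℝ) ≤ (c '' (⊤ : SimpleGraph (Fin 2)).edgeSet).ncard := by exact_mod_cast h1
  have h3 : (0 : ℝ) ≤ g := by
    push_cast at h
    linarith
  exact_mod_cast h3

end EdgePrecoloring

theorem mainTheorem3 :
    (∃ D : ℕ, ∀ d : ℕ, D ≤ d →
      ∀ (V : Type*) [Fintype V] (G : SimpleGraph V) [DecidableRel G.Adj],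
        G.maxDegree ≤ d →
        EdgePrecoloring.LeafPrecoloringsExtend G d ((d : ℝ) + 9 * Real.sqrt (d : ℝ))) ∧
    (∀ k : ℕ, 1 ≤ k →
      IsLeast (EdgePrecoloring.admissible k) (EdgePrecoloring.f k)) ∧
    Asymptotics.IsBigO Filter.atTop
      (fun k : ℕ => (EdgePrecoloring.f k : ℝ)) (fun k : ℕ => Real.sqrt (k : ℝ)) := by
  obtain ⟨D, hD⟩ := EdgePrecoloring.exists_forall_mem_admissible
  have hbdd : ∀ k : ℕ, 1 ≤ k → BddBelow (EdgePrecoloring.admissible k) := fun k hk =>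
    ⟨0, fun _ => EdgePrecoloring.nonneg_of_mem_admissible hk⟩
  have hceil : ∀ k : ℕ, ⌈9 * Real.sqrt (k + 1) + 1 + D⌉ ∈ EdgePrecoloring.admissible k :=
    fun k => hD k _ (Int.le_ceil _)
  have hmem : ∀ k : ℕ, 1 ≤ k → EdgePrecoloring.f k ∈ EdgePrecoloring.admissible k :=
    fun k hk => Int.csInf_mem ⟨_, hceil k⟩ (hbdd k hk)
  refine ⟨?_, fun k hk => ⟨hmem k hk, fun g hg => csInf_le (hbdd k hk) hg⟩, ?_⟩
  · obtain ⟨D', hD'⟩ := EdgePrecoloring.exists_forall_leafPrecoloringsExtend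
    exact ⟨D', fun d hd V _ G _ hG =>
      hD' d hd V G fun v => (G.degree_le_maxDegree v).trans hG⟩
  -- For `k ≥ 1`, `9√(k+1) ≤ 18√k`, while the added 1 and the rounding cost at most `2√k` and `D ≤
  -- D√k`.
  · refine Asymptotics.IsBigO.of_bound (20 + D) (Filter.eventually_atTop.2 ⟨1, fun k hk => ?_⟩)
    have h0 : (0 : ℝ) ≤ EdgePrecoloring.f k := by
      exact_mod_cast EdgePrecoloring.nonneg_of_mem_admissible hk (hmem k hk)
    rw [Real.norm_of_nonneg h0, Real.norm_of_nonneg (Real.sqrt_nonneg _)]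
    have h1 : (EdgePrecoloring.f k : ℝ) ≤ (⌈9 * Real.sqrt (k + 1) + 1 + D⌉ : ℤ) := by
      exact_mod_cast csInf_le (hbdd k hk) (hceil k)
    have h2 := Int.ceil_lt_add_one (9 * Real.sqrt ((k : ℝ) + 1) + 1 + D)
    have hk' : (1 : ℝ) ≤ k := by exact_mod_cast hk
    have h3 : 1 ≤ Real.sqrt k := Real.one_le_sqrt.2 hk'
    have h4 : Real.sqrt ((k : ℝ) + 1) ≤ 2 * Real.sqrt k := by
      rw [Real.sqrt_le_left (by positivity), mul_pow, Real.sq_sqrt (by positivity)]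
      linarith
    have h5 : (D : ℝ) ≤ D * Real.sqrt k := le_mul_of_one_le_right (Nat.cast_nonneg D) h3
    linarith
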